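/- For an open set $\Omega\subset\mathbb{C}^n$ let $\mathrm{Aut}(\Omega)$ be the group of all biholomorphic mappings of $\Omega$ onto itself, equipped with the compact-open topology; a domain (nonempty connected open set) $\Omega$ is called homogeneous if $\mathrm{Aut}(\Omega)$ acts transitively on $\Omega$. For every $n\ge 5$ there exist two unbounded homogeneous domains in $\mathbb{C}^n$ which are not biholomorphically equivalent, while their automorphism groups are isomorphic as topological groups. More precisely, let $p,q>1$ be integers with $p\ne q$, and put $$D^{p,q}=\{(z,w)\in\mathbb{C}^p\times\mathbb{C}^q : |z_1|^2+\cdots+|z_p|^2-|w_1|^2-\cdots-|w_q|^2>0\},$$ $$C^{p,q}=\{(z,w)\in\mathbb{C}^p\times\mathbb{C}^q : |z_1|^2+\cdots+|z_p|^2-|w_1|^2-\cdots-|w_q|^2<0\}.$$ Then $D^{p,q}$ and $C^{p,q}$ are unbounded homogeneous domains in $\mathbb{C}^{p+q}$ which are not biholomorphically equivalent, and there is an isomorphism of topological groups $\varphi:\mathrm{Aut}(D^{p,q})\to\mathrm{Aut}(C^{p,q})$ such that every $f\in\mathrm{Aut}(D^{p,q})$ is the restriction to $D^{p,q}$ of some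 biholomorphic mapping $F$ of $\mathbb{C}^{p+q}$ onto itself with $F|_{C^{p,q}}=\varphi(f)$. -/

import Mathlib

open scoped BigOperators

namespace HolomorphicDomain

/-- The complex euclidean space of dimension `n`. -/
abbrev CSpace (n : ℕ) : Type := EuclideanSpace ℂ (Fin n)

/-- A domain of `ℂⁿ`: a nonempty, open and connected subset. -/
def IsCDomain {n : ℕ} (Ω : Set (CSpace n)) : Prop :=
  IsOpen Ω ∧ IsConnected Ω

/-- A map between open subsets `U` of `ℂⁿ` and `V` of `ℂᵐ` is holomorphic if it is complex
differentiable on `U`. The map lives on the subtype, so differentiability is stated for a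
function on `ℂⁿ` that agrees with it on `U`; the values of that function off `U` are irrelevant. -/
def IsHolomorphic {n m : ℕ} {U : Set (CSpace n)} {V : Set (CSpace m)} (f : U → V) : Prop :=
  ∃ F : CSpace n → CSpace m, DifferentiableOn ℂ F U ∧ ∀ x : U, F x = f x

theorem IsHolomorphic.id {n : ℕ} (U : Set (CSpace n)) : IsHolomorphic (fun x : U => x) :=
  ⟨fun x => x, differentiableOn_id, fun _ => rfl⟩

theorem IsHolomorphic.comp {n m k : ℕ} {U : Set (CSpace n)} {V : Set (CSpace m)}
    {W : Set (CSpace k)} {g : V → W} {f : U → V} (hg : IsHolomorphic g) (hf : IsHolomorphic f) :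
    IsHolomorphic (fun x => g (f x)) := by
  obtain ⟨G, hG, hGg⟩ := hg
  obtain ⟨F, hF, hFf⟩ := hf
  refine ⟨fun x => G (F x), hG.comp hF ?_, fun x => ?_⟩
  · intro x hx
    rw [hFf ⟨x, hx⟩]
    exact (f ⟨x, hx⟩).2
  · change G (F x) = _
    rw [hFf x, hGg (f x)]

theorem IsHolomorphic.continuous {n m : ℕ} {U : Set (CSpace n)} {V : Set (CSpace m)} {f : U → V}
    (hf : IsHolomorphic f) : Continuous f := by
  obtain ⟨F, hF, hFf⟩ := hf
  rw [continuous_induced_rng]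
  have h : (Subtype.val ∘ f) = U.domRestrict F := funext fun x => (hFf x).symm
  rw [h]
  exact hF.continuousOn.domRestrict

/-- Two open subsets are biholomorphically equivalent if there is a holomorphic bijection between
them whose inverse is holomorphic. -/
def Biholomorphic {n m : ℕ} (U : Set (CSpace n)) (V : Set (CSpace m)) : Prop :=
  ∃ e : U ≃ V, IsHolomorphic e ∧ IsHolomorphic e.symm

/-- The group of all biholomorphic mappings of `Ω` onto itself, under composition. -/
def Aut {n : ℕ} (Ω : Set (CSpace n)) : Subgroup (Equiv.Perm Ω) where
  carrier := {f | IsHolomorphic f ∧ IsHolomorphic f.symm}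
  one_mem' := ⟨IsHolomorphic.id Ω, IsHolomorphic.id Ω⟩
  mul_mem' := fun {_ _} hf hg => ⟨hf.1.comp hg.1, hg.2.comp hf.2⟩
  inv_mem' := fun {_} hf => ⟨hf.2, hf.1⟩

/-- An automorphism, as a continuous map of `Ω` to itself. -/
noncomputable def Aut.toContinuousMap {n : ℕ} {Ω : Set (CSpace n)} (f : Aut Ω) : C(Ω, Ω) :=
  ⟨(f : Equiv.Perm Ω), f.2.1.continuous⟩

/-- The compact-open topology on the automorphism group. -/
noncomputable instance Aut.compactOpen {n : ℕ} (Ω : Set (CSpace n)) : TopologicalSpace (Aut Ω) :=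
  TopologicalSpace.induced Aut.toContinuousMap ContinuousMap.compactOpen

/-- `Ω` is homogeneous if its automorphism group acts transitively on it. -/
def IsHomogeneous {n : ℕ} (Ω : Set (CSpace n)) : Prop :=
  ∀ x y : Ω, ∃ f ∈ Aut Ω, f x = y

/-- An unbounded homogeneous domain of `ℂⁿ`. -/
def IsUnboundedHomogeneousDomain {n : ℕ} (Ω : Set (CSpace n)) : Prop :=
  IsCDomain Ω ∧ ¬ Bornology.IsBounded Ω ∧ IsHomogeneous Ω

/-- The form `|z₁|² + ⋯ + |z_p|² - |w₁|² - ⋯ - |w_q|²` at the point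
`(z₁, …, z_p, w₁, …, w_q)` of `ℂ^(p+q)`. -/
noncomputable def hermForm (p q : ℕ) (x : CSpace (p + q)) : ℝ :=
  ∑ i : Fin p, ‖x (Fin.castAdd q i)‖ ^ 2 - ∑ j : Fin q, ‖x (Fin.natAdd p j)‖ ^ 2

/-- The domain on which the form of signature `(p, q)` is positive. -/
def domD (p q : ℕ) : Set (CSpace (p + q)) := {x | 0 < hermForm p q x}

/-- The domain on which the form of signature `(p, q)` is negative. -/
def domC (p q : ℕ) : Set (CSpace (p + q)) := {x | hermForm p q x < 0}

end HolomorphicDomain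

/-! Both domains are cones `posCone ε` with `ε = ±1` and at least two positive coefficients; `C` is
the cone of the opposite form. Everything rests on a Hartogs phenomenon
(`exists_entire_extension_posCone`): holomorphic maps on such a cone extend to entire maps. In a
positive coordinate direction all large circles lie in the cone, so a Cauchy integral in that
coordinate defines an entire map; a second positive coordinate serves to continue the identity with
the given map to the whole cone.

An automorphism of `D` and its inverse therefore extend to mutually inverse entire maps. The
extension is a homeomorphism preserving `D`, hence preserving the exterior of `D`, which is `C`.
Restricting it to `C` defines `φ`; the same construction from `C` is inverse to it. Continuity comes
from the maximum principle, which bounds entire maps on a compact set by their values on a compact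
subset of the cone.

A biholomorphic map from `D` to `C` would likewise extend to some `F` exchanging the cones. Then `F
0` is a null vector, a first-order argument shows `F 0 = 0`, and the derivative at `0` sends
positive vectors to vectors of nonpositive form. Comparing dimensions gives `p ≤ q`, and by symmetry
`q ≤ p`.

Homogeneity follows from scalings and quasi-reflections that preserve the form. -/

namespace HolomorphicDomain
open Metric Set Filter Topology MeasureTheory

/-! ### Holomorphic dependence of circle integrals on parameters -/

section Parametric

/-- Cauchy's estimate for the derivative of a map of several complex variables. -/
theorem norm_fderiv_le_of_forall_mem_closedBall
    {E X : Type*} [NormedAddCommGroup E] [NormedSpace ℂ E] [NormedAddCommGroup X] [NormedSpace ℂ X]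
    {G : E → X} {x : E} {r M : ℝ} (hr : 0 < r)
    (hd : ∀ y ∈ closedBall x r, DifferentiableAt ℂ G y) (hM : ∀ y ∈ closedBall x r, ‖G y‖ ≤ M) :
    ‖fderiv ℂ G x‖ ≤ M / r := by
  have hM0 : 0 ≤ M := (norm_nonneg _).trans (hM x (mem_closedBall_self hr.le))
  refine ContinuousLinearMap.opNorm_le_of_unit_norm (𝕜 := ℂ) (by positivity) fun v hv => ?_
  have hmem : ∀ t ∈ closedBall (0 : ℂ) r, x + t • v ∈ closedBall x r := fun t ht => by
    simpa [norm_smul, hv] using ht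
  have hline : ∀ t : ℂ, HasDerivAt (fun t : ℂ => x + t • v) v t := fun t => by
    simpa using ((hasDerivAt_id t).smul_const v).const_add x
  have hder : deriv (fun t : ℂ => G (x + t • v)) 0 = fderiv ℂ G x v := by
    have h := (hd x (mem_closedBall_self hr.le)).hasFDerivAt
    have h' : HasFDerivAt G (fderiv ℂ G x) (x + (0 : ℂ) • v) := by simpa using h
    exact (h'.comp_hasDerivAt (0 : ℂ) (hline 0)).deriv
  rw [← hder]
  refine Complex.norm_deriv_le_of_forall_mem_sphere_norm_le hr ?_ fun t ht =>
    hM _ (hmem t (sphere_subset_closedBall ht))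
  refine DifferentiableOn.diffContOnCl fun t ht => ?_
  have := hd _ (hmem t (closure_ball_subset_closedBall ht))
  exact (this.comp t (hline t).differentiableAt).differentiableWithinAt

variable {E X : Type*} [NormedAddCommGroup E] [NormedSpace ℂ E] [FiniteDimensional ℂ E]
  [NormedAddCommGroup X] [NormedSpace ℂ X] [FiniteDimensional ℂ X]

/-- A circle integral depends holomorphically on parameters. -/
theorem differentiableAt_circleIntegral {G : E × ℂ → X} {O : Set (E × ℂ)} (hO : IsOpen O)
    (hG : DifferentiableOn ℂ G O) {x₀ : E} {R : ℝ} (hR : 0 ≤ R)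
    (hK : ∀ ζ ∈ sphere (0 : ℂ) R, (x₀, ζ) ∈ O) :
    DifferentiableAt ℂ (fun x => ∮ ζ in C(0, R), G (x, ζ)) x₀ := by
  have : ProperSpace E := FiniteDimensional.proper ℂ E
  have : ProperSpace X := FiniteDimensional.proper ℂ X
  have : CompleteSpace X := FiniteDimensional.complete ℂ X
  have hKc : IsCompact ((fun ζ : ℂ => (x₀, ζ)) '' sphere (0 : ℂ) R) :=
    (isCompact_sphere _ _).image (by fun_prop)
  obtain ⟨δ, hδ, hsub⟩ := hKc.exists_cthickening_subset_open hO (by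
    rintro _ ⟨ζ, hζ, rfl⟩; exact hK ζ hζ)
  obtain ⟨M, hM⟩ := (hKc.cthickening (r := δ)).exists_bound_of_continuousOn
    (hG.continuousOn.mono hsub)
  -- Half of `δ` is spent on moving `x`; the other half is the radius for Cauchy's estimate, which
  -- turns the bound `M` on `G` into the bound `M / (δ / 2)` on its derivative.
  have hball : ∀ x ∈ ball x₀ (δ / 2), ∀ ζ ∈ sphere (0 : ℂ) R,
      closedBall (x, ζ) (δ / 2) ⊆ cthickening δ ((fun ζ : ℂ => (x₀, ζ)) '' sphere (0 : ℂ) R) := by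
    intro x hx ζ hζ y hy
    refine mem_cthickening_of_dist_le y (x₀, ζ) δ _ ⟨ζ, hζ, rfl⟩ ?_
    have h1 : dist (x, ζ) (x₀, ζ) ≤ δ / 2 := by
      simpa [Prod.dist_eq, hδ.le] using (mem_ball.1 hx).le
    linarith [dist_triangle y (x, ζ) (x₀, ζ), mem_closedBall.1 hy]
  have hdiff : ∀ x ∈ ball x₀ (δ / 2), ∀ ζ ∈ sphere (0 : ℂ) R, DifferentiableAt ℂ G (x, ζ) :=
    fun x hx ζ hζ => hG.differentiableAt
      (hO.mem_nhds (hsub (hball x hx ζ hζ (mem_closedBall_self (by positivity)))))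
  have hmem : ∀ θ, circleMap 0 R θ ∈ sphere (0 : ℂ) R := circleMap_mem_sphere 0 hR
  have hcont : ∀ x ∈ ball x₀ (δ / 2),
      Continuous fun θ => deriv (circleMap 0 R) θ • G (x, circleMap 0 R θ) := by
    intro x hx
    simp only [deriv_circleMap]
    refine Continuous.smul (by fun_prop) (continuous_iff_continuousAt.2 fun θ => ?_)
    exact ContinuousAt.comp (f := fun θ => (x, circleMap 0 R θ))
      (hdiff x hx _ (hmem θ)).continuousAt (by fun_prop)
  have hx₀ : ball x₀ (δ / 2) ∈ 𝓝 x₀ := ball_mem_nhds _ (by positivity)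
  refine HasFDerivAt.differentiableAt (f' := ∫ θ in (0)..2 * Real.pi,
    deriv (circleMap 0 R) θ • (fderiv ℂ G (x₀, circleMap 0 R θ)).comp
      (ContinuousLinearMap.inl ℂ E ℂ)) ?_
  refine intervalIntegral.hasFDerivAt_integral_of_dominated_of_fderiv_le
    (F' := fun x θ => deriv (circleMap 0 R) θ • (fderiv ℂ G (x, circleMap 0 R θ)).comp
      (ContinuousLinearMap.inl ℂ E ℂ)) (bound := fun _ => R * (M / (δ / 2))) hx₀ ?_ ?_ ?_ ?_ ?_ ?_
  · exact eventually_of_mem hx₀ fun x hx => (hcont x hx).aestronglyMeasurable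
  · exact (hcont x₀ (mem_of_mem_nhds hx₀)).intervalIntegrable _ _
  · borelize E
    borelize (E × ℂ →L[ℂ] X)
    have h1 : StronglyMeasurable fun θ : ℝ => fderiv ℂ G (x₀, circleMap 0 R θ) :=
      ((measurable_fderiv ℂ G).comp
        (Continuous.measurable (by fun_prop : Continuous fun θ : ℝ => (x₀, circleMap 0 R θ)))
        ).stronglyMeasurable
    have h2 : StronglyMeasurable fun θ : ℝ => (fderiv ℂ G (x₀, circleMap 0 R θ)).comp
        (ContinuousLinearMap.inl ℂ E ℂ) :=
      (((ContinuousLinearMap.compL ℂ E (E × ℂ) X).flip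
        (ContinuousLinearMap.inl ℂ E ℂ)).continuous.comp_stronglyMeasurable h1)
    have h3 : Continuous fun θ : ℝ => deriv (circleMap 0 R) θ := by
      simp only [deriv_circleMap]; fun_prop
    exact (h3.stronglyMeasurable.smul h2).aestronglyMeasurable
  · refine Eventually.of_forall fun θ _ x hx => ?_
    have h1 : ‖fderiv ℂ G (x, circleMap 0 R θ)‖ ≤ M / (δ / 2) :=
      norm_fderiv_le_of_forall_mem_closedBall (by positivity)
        (fun y hy => hG.differentiableAt (hO.mem_nhds (hsub (hball x hx _ (hmem θ) hy))))
        (fun y hy => hM y (hball x hx _ (hmem θ) hy))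
    have h2 : ‖(fderiv ℂ G (x, circleMap 0 R θ)).comp (ContinuousLinearMap.inl ℂ E ℂ)‖
        ≤ M / (δ / 2) := by
      refine (ContinuousLinearMap.opNorm_comp_le _ _).trans ?_
      calc _ ≤ ‖fderiv ℂ G (x, circleMap 0 R θ)‖ * 1 := by
            gcongr; exact ContinuousLinearMap.norm_inl_le_one ℂ E ℂ
        _ ≤ _ := by simpa using h1
    rw [norm_smul]
    have h3 : ‖deriv (circleMap 0 R) θ‖ = R := by simp [deriv_circleMap, abs_of_nonneg hR]
    rw [h3]
    gcongr
  · exact intervalIntegrable_const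
  · refine Eventually.of_forall fun θ _ x hx => ?_
    have h := (hdiff x hx _ (hmem θ)).hasFDerivAt
    have h' : HasFDerivAt (fun y : E => (y, circleMap 0 R θ)) (ContinuousLinearMap.inl ℂ E ℂ) x :=
      hasFDerivAt_prodMk_left x _
    exact (h.comp x h').const_smul _

end Parametric

/-! ### The identity theorem for entire maps -/

section Uniqueness

variable {E X : Type*} [NormedAddCommGroup E] [NormedSpace ℂ E]
  [NormedAddCommGroup X] [NormedSpace ℂ X] [CompleteSpace X]

/-- Entire maps that agree on a nonempty open set agree everywhere. -/
theorem entire_eq_of_eqOn {F G : E → X} (hF : Differentiable ℂ F) (hG : Differentiable ℂ G)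
    {U : Set E} (hU : IsOpen U) (hne : U.Nonempty) (h : EqOn F G U) : F = G := by
  obtain ⟨x, hx⟩ := hne
  funext y
  -- The complex line through `x` and `y` reduces the claim to one variable; `t = 1` gives `y`.
  have hl : Differentiable ℂ fun t : ℂ => x + t • (y - x) := by fun_prop
  have hFl : AnalyticOnNhd ℂ (fun t : ℂ => F (x + t • (y - x))) univ :=
    (hF.comp hl).differentiableOn.analyticOnNhd isOpen_univ
  have hGl : AnalyticOnNhd ℂ (fun t : ℂ => G (x + t • (y - x))) univ :=
    (hG.comp hl).differentiableOn.analyticOnNhd isOpen_univ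
  have hev : (fun t : ℂ => F (x + t • (y - x))) =ᶠ[𝓝 0] fun t : ℂ => G (x + t • (y - x)) := by
    have : ∀ᶠ t : ℂ in 𝓝 0, x + t • (y - x) ∈ U :=
      hl.continuous.continuousAt.eventually_mem (hU.mem_nhds (by simpa using hx))
    exact this.mono fun t ht => h ht
  simpa using congrFun (hFl.eq_of_eventuallyEq hGl hev) 1

end Uniqueness

/-! ### Hartogs extension from the positive cone -/

section SignedForm

variable {n : ℕ}

/-- The diagonal hermitian form with coefficients `ε`. -/
noncomputable def signedForm (ε : Fin n → ℝ) (x : CSpace n) : ℝ := ∑ k, ε k * ‖x k‖ ^ 2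

/-- The cone on which a diagonal hermitian form is positive. -/
def posCone (ε : Fin n → ℝ) : Set (CSpace n) := {x | 0 < signedForm ε x}

theorem signedForm_neg (ε : Fin n → ℝ) (x : CSpace n) : signedForm (-ε) x = -signedForm ε x := by
  simp [signedForm]

theorem signedForm_smul (ε : Fin n → ℝ) (c : ℂ) (x : CSpace n) :
    signedForm ε (c • x) = ‖c‖ ^ 2 * signedForm ε x := by
  simp only [signedForm, Finset.mul_sum, PiLp.smul_apply, norm_smul]
  exact Finset.sum_congr rfl fun k _ => by ring

theorem continuous_signedForm (ε : Fin n → ℝ) : Continuous (signedForm ε) := by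
  unfold signedForm; fun_prop

theorem isOpen_posCone (ε : Fin n → ℝ) : IsOpen (posCone ε) :=
  isOpen_lt continuous_const (continuous_signedForm ε)

/-- The point obtained from `x` by replacing its `i`-th coordinate by `ζ`. -/
noncomputable def setCoord (i : Fin n) (x : CSpace n) (ζ : ℂ) : CSpace n :=
  x + (ζ - x i) • EuclideanSpace.single i 1

theorem setCoord_same (i : Fin n) (x : CSpace n) (ζ : ℂ) : setCoord i x ζ i = ζ := by
  simp [setCoord]

theorem setCoord_ne {i k : Fin n} (h : k ≠ i) (x : CSpace n) (ζ : ℂ) :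
    setCoord i x ζ k = x k := by
  simp [setCoord, h]

theorem setCoord_self (i : Fin n) (x : CSpace n) : setCoord i x (x i) = x := by
  simp [setCoord]

theorem differentiable_setCoord (i : Fin n) :
    Differentiable ℂ fun p : CSpace n × ℂ => setCoord i p.1 p.2 := by
  unfold setCoord
  have : Differentiable ℂ fun p : CSpace n × ℂ => p.1 i :=
    (EuclideanSpace.proj (𝕜 := ℂ) i).differentiable.comp differentiable_fst
  fun_prop

theorem signedForm_setCoord (ε : Fin n → ℝ) (i : Fin n) (x : CSpace n) (ζ : ℂ) :
    signedForm ε (setCoord i x ζ) = signedForm ε x + ε i * (‖ζ‖ ^ 2 - ‖x i‖ ^ 2) := by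
  unfold signedForm
  rw [← Finset.add_sum_erase _ _ (Finset.mem_univ i),
    ← Finset.add_sum_erase Finset.univ (fun k => ε k * ‖x k‖ ^ 2) (Finset.mem_univ i),
    setCoord_same, Finset.sum_congr rfl fun k hk => by rw [setCoord_ne (Finset.ne_of_mem_erase hk)]]
  ring

theorem abs_signedForm_le {ε : Fin n → ℝ} (hε : ∀ k, |ε k| ≤ 1) (x : CSpace n) :
    |signedForm ε x| ≤ ‖x‖ ^ 2 := by
  rw [EuclideanSpace.norm_sq_eq]
  refine (Finset.abs_sum_le_sum_abs _ _).trans (Finset.sum_le_sum fun k _ => ?_)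
  rw [abs_mul, abs_of_nonneg (sq_nonneg ‖x k‖)]
  nlinarith [hε k, sq_nonneg ‖x k‖]

/-- Off the `i`-th coordinate the form is bounded below by minus the square of the norm. -/
theorem sq_norm_coord_sub_le {ε : Fin n → ℝ} (hε : ∀ k, |ε k| ≤ 1) {i : Fin n} (hi : ε i = 1)
    (x : CSpace n) : ‖x i‖ ^ 2 - signedForm ε x ≤ ‖x‖ ^ 2 := by
  -- Setting `x i` to `0` lowers the form by `‖x i‖ ^ 2` and does not increase the norm.
  have h1 := neg_le_of_abs_le (abs_signedForm_le hε (setCoord i x 0))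
  have h2 : ‖setCoord i x 0‖ ^ 2 ≤ ‖x‖ ^ 2 := by
    rw [EuclideanSpace.norm_sq_eq, EuclideanSpace.norm_sq_eq]
    refine Finset.sum_le_sum fun k _ => ?_
    by_cases h : k = i
    · subst h; rw [setCoord_same]; simp
    · rw [setCoord_ne h]
  rw [signedForm_setCoord, hi] at h1
  norm_num at h1
  linarith

/-- On compact sets an entire map is bounded by its values on a compact subset of the cone. -/
theorem exists_isCompact_posCone_bound {ε : Fin n → ℝ} (hε : ∀ k, |ε k| ≤ 1) {i : Fin n}
    (hi : ε i = 1) {K : Set (CSpace n)} (hK : IsCompact K) :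
    ∃ L ⊆ posCone ε, IsCompact L ∧ ∀ G : CSpace n → CSpace n, Differentiable ℂ G →
      ∀ M, (∀ x ∈ L, ‖G x‖ ≤ M) → ∀ x ∈ K, ‖G x‖ ≤ M := by
  obtain ⟨r, hr, hKr⟩ := hK.isBounded.subset_closedBall_lt 0 0
  -- When `‖x‖ ≤ r`, a new `i`-th coordinate of modulus `r + 1` makes the form at least `(r + 1) ^ 2
  -- - r ^ 2 > 0`. The maximum principle on the disc of radius `r + 1` in that coordinate then gives
  -- the bound.
  refine ⟨(fun p : CSpace n × ℂ => setCoord i p.1 p.2) '' (closedBall 0 r ×ˢ sphere 0 (r + 1)),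
    ?_, ((isCompact_closedBall _ _).prod (isCompact_sphere _ _)).image
      (differentiable_setCoord i).continuous, ?_⟩
  · rintro _ ⟨⟨x, ζ⟩, ⟨hx, hζ⟩, rfl⟩
    simp only [mem_closedBall, dist_zero_right, mem_sphere_iff_norm, sub_zero] at hx hζ
    simp only [posCone, mem_ofPred_eq, signedForm_setCoord, hi, hζ]
    have := sq_norm_coord_sub_le hε hi x
    nlinarith [norm_nonneg x]
  · intro G hG M hM x hx
    have hx' : ‖x‖ ≤ r := by simpa using hKr hx
    have hxi : ‖x i‖ ≤ ‖x‖ := PiLp.norm_apply_le x i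
    have hd : Differentiable ℂ fun ζ : ℂ => G (setCoord i x ζ) :=
      hG.comp ((differentiable_setCoord i).comp
        (by fun_prop : Differentiable ℂ fun ζ : ℂ => (x, ζ)))
    have := Complex.norm_le_of_forall_mem_frontier_norm_le (U := ball (0 : ℂ) (r + 1))
      isBounded_ball hd.diffContOnCl (C := M) (z := x i) (fun ζ hζ => ?_)
      (subset_closure (by simp; linarith))
    · simpa [setCoord_self] using this
    · rw [frontier_ball _ (by positivity)] at hζ
      exact hM _ ⟨(x, ζ), ⟨hKr hx, hζ⟩, rfl⟩

/-- The Cauchy integral of `g` over the circle of radius `R` in the `i`-th coordinate. -/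
noncomputable def coordCauchy (i : Fin n) (g : CSpace n → CSpace n) (R : ℝ) (x : CSpace n) :
    CSpace n :=
  (2 * Real.pi * Complex.I : ℂ)⁻¹ • ∮ ζ in C(0, R), (ζ - x i)⁻¹ • g (setCoord i x ζ)

theorem setCoord_mem_posCone {ε : Fin n → ℝ} {i : Fin n} (hi : ε i = 1) {x : CSpace n} {ζ : ℂ}
    (h : ‖x i‖ ^ 2 - signedForm ε x < ‖ζ‖ ^ 2) : setCoord i x ζ ∈ posCone ε := by
  simp only [posCone, mem_ofPred_eq, signedForm_setCoord, hi]
  linarith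

theorem differentiableOn_setCoord {ε : Fin n → ℝ} {i : Fin n} (hi : ε i = 1)
    {g : CSpace n → CSpace n} (hg : DifferentiableOn ℂ g (posCone ε)) (x : CSpace n) {S : Set ℂ}
    (hS : ∀ ζ ∈ S, ‖x i‖ ^ 2 - signedForm ε x < ‖ζ‖ ^ 2) :
    DifferentiableOn ℂ (fun ζ => g (setCoord i x ζ)) S :=
  hg.comp ((differentiable_setCoord i).comp
    (by fun_prop : Differentiable ℂ fun ζ : ℂ => (x, ζ))).differentiableOn
    fun ζ hζ => setCoord_mem_posCone hi (hS ζ hζ)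

/-- The integrand is holomorphic between the two circles: `hr` keeps the pole inside the smaller
one, and `hx` puts every point with `r ≤ ‖ζ‖` in the cone. -/
theorem coordCauchy_eq_of_le {ε : Fin n → ℝ} {i : Fin n} (hi : ε i = 1)
    {g : CSpace n → CSpace n} (hg : DifferentiableOn ℂ g (posCone ε)) {x : CSpace n} {r R : ℝ}
    (hrR : r ≤ R) (hr : ‖x i‖ < r) (hx : ‖x i‖ ^ 2 - signedForm ε x < r ^ 2) :
    coordCauchy i g R x = coordCauchy i g r x := by
  have hr0 : 0 < r := (norm_nonneg _).trans_lt hr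
  unfold coordCauchy
  congr 1
  have hd : DifferentiableOn ℂ (fun ζ => (ζ - x i)⁻¹ • g (setCoord i x ζ))
      {ζ | ‖x i‖ < ‖ζ‖ ∧ ‖x i‖ ^ 2 - signedForm ε x < ‖ζ‖ ^ 2} := by
    intro ζ hζ
    have h0 : ζ - x i ≠ 0 := fun h => by
      rw [sub_eq_zero.1 h] at hζ
      exact lt_irrefl _ hζ.1
    have h1 : DifferentiableAt ℂ (fun ζ => (ζ - x i)⁻¹) ζ := DifferentiableAt.inv (by fun_prop) h0
    exact h1.differentiableWithinAt.smul
      (differentiableOn_setCoord hi hg x (fun ζ hζ => hζ.2) ζ hζ)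
  have hopen : IsOpen {ζ : ℂ | ‖x i‖ < ‖ζ‖ ∧ ‖x i‖ ^ 2 - signedForm ε x < ‖ζ‖ ^ 2} :=
    (isOpen_lt continuous_const continuous_norm).inter
      (isOpen_lt continuous_const (continuous_norm.pow 2))
  have hmem : ∀ ζ : ℂ, r ≤ ‖ζ‖ →
      ζ ∈ {ζ : ℂ | ‖x i‖ < ‖ζ‖ ∧ ‖x i‖ ^ 2 - signedForm ε x < ‖ζ‖ ^ 2} := fun ζ hζ =>
    ⟨hr.trans_le hζ, hx.trans_le (pow_le_pow_left₀ hr0.le hζ 2)⟩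
  refine Complex.circleIntegral_eq_of_differentiable_on_annulus_off_countable hr0 hrR
    countable_empty (hd.continuousOn.mono fun ζ hζ => hmem ζ ?_)
    fun ζ hζ => hd.differentiableAt (hopen.mem_nhds (hmem ζ ?_))
  · simpa using hζ.2
  · have := hζ.1.2
    simp only [mem_closedBall, dist_zero_right, not_le] at this
    exact this.le

theorem differentiableAt_coordCauchy {ε : Fin n → ℝ} {i : Fin n} (hi : ε i = 1)
    {g : CSpace n → CSpace n} (hg : DifferentiableOn ℂ g (posCone ε)) {x : CSpace n} {R : ℝ}
    (hR : ‖x i‖ < R) (hx : ‖x i‖ ^ 2 - signedForm ε x < R ^ 2) :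
    DifferentiableAt ℂ (coordCauchy i g R) x := by
  have hci : Continuous fun p : CSpace n × ℂ => p.1 i :=
    (EuclideanSpace.proj (𝕜 := ℂ) i).continuous.comp continuous_fst
  have hdi : Differentiable ℂ fun p : CSpace n × ℂ => p.1 i :=
    (EuclideanSpace.proj (𝕜 := ℂ) i).differentiable.comp differentiable_fst
  have hO : IsOpen {p : CSpace n × ℂ | p.2 - p.1 i ≠ 0 ∧ setCoord i p.1 p.2 ∈ posCone ε} :=
    (isOpen_ne_fun (by fun_prop) continuous_const).inter
      ((isOpen_posCone ε).preimage (differentiable_setCoord i).continuous)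
  have hG : DifferentiableOn ℂ (fun p : CSpace n × ℂ => (p.2 - p.1 i)⁻¹ • g (setCoord i p.1 p.2))
      {p : CSpace n × ℂ | p.2 - p.1 i ≠ 0 ∧ setCoord i p.1 p.2 ∈ posCone ε} := by
    intro p hp
    have h1 : DifferentiableAt ℂ (fun p : CSpace n × ℂ => (p.2 - p.1 i)⁻¹) p :=
      DifferentiableAt.inv (by fun_prop) hp.1
    exact h1.differentiableWithinAt.smul
      (hg.comp (differentiable_setCoord i).differentiableOn (fun p hp => hp.2) p hp)
  have hK : ∀ ζ ∈ sphere (0 : ℂ) R,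
      (x, ζ) ∈ {p : CSpace n × ℂ | p.2 - p.1 i ≠ 0 ∧ setCoord i p.1 p.2 ∈ posCone ε} := by
    intro ζ hζ
    have hζ' : ‖ζ‖ = R := by simpa using hζ
    refine ⟨fun h => ?_, setCoord_mem_posCone hi (by rwa [hζ'])⟩
    rw [← sub_eq_zero.1 h, hζ'] at hR
    exact lt_irrefl _ hR
  have h := differentiableAt_circleIntegral hO hG ((norm_nonneg _).trans hR.le) hK
  exact h.const_smul (2 * Real.pi * Complex.I : ℂ)⁻¹

/-- By `hx` the form stays positive when `x i` is replaced by `0`, so the whole complex line through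
`x` in direction `i` lies in the cone and Cauchy's formula applies. -/
theorem coordCauchy_eq_self {ε : Fin n → ℝ} {i : Fin n} (hi : ε i = 1)
    {g : CSpace n → CSpace n} (hg : DifferentiableOn ℂ g (posCone ε)) {x : CSpace n} {R : ℝ}
    (hR : ‖x i‖ < R) (hx : ‖x i‖ ^ 2 - signedForm ε x < 0) : coordCauchy i g R x = g x := by
  have hd : DifferentiableOn ℂ (fun ζ => g (setCoord i x ζ)) (closedBall 0 R) :=
    differentiableOn_setCoord hi hg x fun ζ _ => hx.trans_le (sq_nonneg _)
  have h2 : (2 * Real.pi * Complex.I : ℂ) ≠ 0 := by simp [Real.pi_ne_zero]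
  rw [coordCauchy, hd.circleIntegral_sub_inv_smul (by simpa using hR), inv_smul_smul₀ h2,
    setCoord_self]

/-- **Hartogs extension**: holomorphic maps on the positive cone of a form with at least two
positive coefficients are restrictions of entire maps. -/
theorem exists_entire_extension_posCone {ε : Fin n → ℝ} (hε : ∀ k, |ε k| ≤ 1) {i j : Fin n}
    (hij : i ≠ j) (hi : ε i = 1) (hj : ε j = 1) {g : CSpace n → CSpace n}
    (hg : DifferentiableOn ℂ g (posCone ε)) :
    ∃ G : CSpace n → CSpace n, Differentiable ℂ G ∧ EqOn G g (posCone ε) := by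
  have hnorm : ∀ x : CSpace n, ‖x i‖ < ‖x‖ + 1 := fun x =>
    (PiLp.norm_apply_le x i).trans_lt (lt_add_one _)
  have hform : ∀ x : CSpace n, ‖x i‖ ^ 2 - signedForm ε x < (‖x‖ + 1) ^ 2 := fun x => by
    have := sq_norm_coord_sub_le hε hi x
    nlinarith [norm_nonneg x]
  -- The radius `‖x‖ + 1` is not holomorphic in `x`, but near a given point it can be frozen, since
  -- the integral does not depend on an admissible radius.
  have hdiff : Differentiable ℂ fun x => coordCauchy i g (‖x‖ + 1) x := by
    intro x
    refine (differentiableAt_coordCauchy hi hg (hnorm x) (hform x)).congr_of_eventuallyEq ?_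
    have hci : Continuous fun y : CSpace n => y i := (EuclideanSpace.proj (𝕜 := ℂ) i).continuous
    have h1 : ∀ᶠ y : CSpace n in 𝓝 x, ‖y i‖ < ‖x‖ + 1 :=
      hci.norm.continuousAt.eventually_lt_const (hnorm x)
    have h2 : ∀ᶠ y : CSpace n in 𝓝 x, ‖y i‖ ^ 2 - signedForm ε y < (‖x‖ + 1) ^ 2 :=
      ((hci.norm.pow 2).sub (continuous_signedForm ε)).continuousAt.eventually_lt_const (hform x)
    filter_upwards [h1, h2] with y hy1 hy2
    rcases le_total (‖x‖ + 1) (‖y‖ + 1) with h | h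
    · exact coordCauchy_eq_of_le hi hg h hy1 hy2
    · exact (coordCauchy_eq_of_le hi hg h (hnorm y) (hform y)).symm
  refine ⟨_, hdiff, fun x hx => ?_⟩
  -- a complex line in the `j`-th coordinate direction, through `x` at a real parameter
  obtain ⟨u, hu, hxu⟩ : ∃ u : ℂ, ‖u‖ = 1 ∧ x j = ‖x j‖ * u := by
    by_cases h : x j = 0
    · exact ⟨1, by simp, by simp [h]⟩
    · have h' : (‖x j‖ : ℂ) ≠ 0 := by simpa using h
      exact ⟨x j / ‖x j‖, by simp [h], by field_simp⟩
  have hx' : 0 < signedForm ε x := hx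
  -- The half-plane `c < t.re` is a connected set of parameters for which `setCoord j x (t * u)`
  -- stays in the cone; it contains `‖x j‖`, the parameter of `x`. If the left side is negative,
  -- every `t` is admissible and `c = -1` will do.
  obtain ⟨c, hc, hcx⟩ : ∃ c < ‖x j‖, ∀ t : ℂ, c < t.re → ‖x j‖ ^ 2 - signedForm ε x < ‖t‖ ^ 2 := by
    by_cases hm : ‖x j‖ ^ 2 - signedForm ε x < 0
    · exact ⟨-1, by linarith [norm_nonneg (x j)], fun t _ => hm.trans_le (sq_nonneg _)⟩
    · refine ⟨√(‖x j‖ ^ 2 - signedForm ε x), ?_, fun t ht => ?_⟩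
      · rw [Real.sqrt_lt' (lt_of_le_of_ne (norm_nonneg _) fun h => ?_)]
        · linarith
        · rw [← h] at hm; norm_num at hm; linarith
      · have := ht.trans_le (Complex.re_le_norm t)
        rwa [Real.sqrt_lt' ((Real.sqrt_nonneg _).trans_lt this)] at this
  have hline : Differentiable ℂ fun t : ℂ => setCoord j x (t * u) :=
    (differentiable_setCoord j).comp
      (by fun_prop : Differentiable ℂ fun t : ℂ => (x, t * u))
  have hTopen : IsOpen {t : ℂ | c < t.re} := isOpen_lt continuous_const Complex.continuous_re
  have hA : AnalyticOnNhd ℂ (fun t : ℂ => coordCauchy i g (‖setCoord j x (t * u)‖ + 1)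
      (setCoord j x (t * u))) {t : ℂ | c < t.re} :=
    (hdiff.comp hline).differentiableOn.analyticOnNhd hTopen
  have hB : AnalyticOnNhd ℂ (fun t : ℂ => g (setCoord j x (t * u))) {t : ℂ | c < t.re} :=
    (hg.comp hline.differentiableOn fun t ht => setCoord_mem_posCone hj
      (by rw [norm_mul, hu, mul_one]; exact hcx t ht)).analyticOnNhd hTopen
  have hconv : IsPreconnected {t : ℂ | c < t.re} := (convex_halfSpace_re_gt c).isPreconnected
  -- Near `t = b` the `j`-th coordinate is so large that the form is positive even without the
  -- `i`-th one, so `coordCauchy_eq_self` applies there.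
  set b : ℝ := |c| + ‖x i‖ + ‖x j‖ + 1 with hb
  have hbpos : 0 < b := by positivity
  have hbmem : (b : ℂ) ∈ {t : ℂ | c < t.re} := by
    simp only [mem_ofPred_eq, Complex.ofReal_re]
    linarith [le_abs_self c, norm_nonneg (x i), norm_nonneg (x j)]
  have hev : (fun t : ℂ => coordCauchy i g (‖setCoord j x (t * u)‖ + 1)
      (setCoord j x (t * u))) =ᶠ[𝓝 (b : ℂ)] fun t : ℂ => g (setCoord j x (t * u)) := by
    have h1 : ∀ᶠ t : ℂ in 𝓝 (b : ℂ), ‖x i‖ ^ 2 + ‖x j‖ ^ 2 < ‖t‖ ^ 2 := by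
      refine (by fun_prop : ContinuousAt (fun t : ℂ => ‖t‖ ^ 2) (b : ℂ)).eventually (lt_mem_nhds ?_)
      change _ < ‖(b : ℂ)‖ ^ 2
      rw [Complex.norm_real, Real.norm_of_nonneg hbpos.le]
      nlinarith [abs_nonneg c, norm_nonneg (x i), norm_nonneg (x j),
        mul_nonneg (norm_nonneg (x i)) (norm_nonneg (x j))]
    filter_upwards [h1] with t ht
    refine coordCauchy_eq_self hi hg (hnorm _) ?_
    rw [signedForm_setCoord, setCoord_ne hij, hj, norm_mul, hu]
    linarith
  have := hA.eqOn_of_preconnected_of_eventuallyEq hB hconv hbmem hev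
    (show ((‖x j‖ : ℝ) : ℂ) ∈ {t : ℂ | c < t.re} by simpa using hc)
  simpa only [← hxu, setCoord_self] using this

end SignedForm

/-! ### The opposite cone as the exterior -/

section Cones

variable {n : ℕ}

theorem exists_unit_mul_norm_eq (z : ℂ) : ∃ u : ℂ, ‖u‖ = 1 ∧ z = ‖z‖ * u := by
  by_cases h : z = 0
  · exact ⟨1, by simp, by simp [h]⟩
  · have h' : (‖z‖ : ℂ) ≠ 0 := by simpa using h
    exact ⟨z / ‖z‖, by simp [h], by field_simp⟩

theorem single_mem_posCone {ε : Fin n → ℝ} {i : Fin n} (hi : ε i = 1) {c : ℂ} (hc : c ≠ 0) :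
    setCoord i 0 c ∈ posCone ε := by
  refine setCoord_mem_posCone hi ?_
  have : 0 < ‖c‖ := norm_pos_iff.2 hc
  simp only [PiLp.zero_apply, norm_zero, signedForm]
  simp
  positivity

/-- The opposite cone is the exterior of the cone. -/
theorem posCone_neg_eq_interior_compl {ε : Fin n → ℝ} {i : Fin n} (hi : ε i = 1) :
    posCone (-ε) = interior (posCone ε)ᶜ := by
  have hmem : ∀ x, x ∈ posCone (-ε) ↔ signedForm ε x < 0 := fun x => by
    simp only [posCone, mem_ofPred_eq, signedForm_neg, neg_pos]
  refine Subset.antisymm (interior_maximal (fun x hx => ?_) (isOpen_posCone _)) fun x hx => ?_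
  · exact not_lt.2 ((hmem x).1 hx).le
  · rw [hmem]
    have hx0 : signedForm ε x ≤ 0 := not_lt.1 (interior_subset hx)
    refine lt_of_le_of_ne hx0 fun h0 => ?_
    -- At a null point, increasing the modulus of `x i` slightly enters the cone, so no null point
    -- is interior to the complement.
    obtain ⟨u, hu, hxu⟩ := exists_unit_mul_norm_eq (x i)
    have hcont : Continuous fun t : ℝ => setCoord i x ((‖x i‖ + t : ℝ) * u) :=
      (differentiable_setCoord i).continuous.comp
        (by fun_prop : Continuous fun t : ℝ => (x, ((‖x i‖ + t : ℝ) : ℂ) * u))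
    have hev : ∀ᶠ t : ℝ in 𝓝 0, setCoord i x ((‖x i‖ + t : ℝ) * u) ∈ interior (posCone ε)ᶜ := by
      refine hcont.continuousAt.eventually_mem (isOpen_interior.mem_nhds ?_)
      rwa [add_zero, ← hxu, setCoord_self]
    obtain ⟨t, ht, ht0⟩ := ((hev.filter_mono nhdsWithin_le_nhds).and
      (self_mem_nhdsWithin : ∀ᶠ t : ℝ in 𝓝[>] 0, t ∈ Ioi 0)).exists
    have ht0 : 0 < t := ht0
    refine interior_subset ht (setCoord_mem_posCone hi ?_)
    rw [norm_mul, hu, Complex.norm_real, Real.norm_of_nonneg (by positivity), h0]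
    nlinarith [norm_nonneg (x i)]

end Cones

/-! ### Global extension and transfer of automorphisms -/

section GlobalExtension

variable {n : ℕ}

/-- An open set whose holomorphic maps extend to entire maps that are controlled, on compact sets,
by their values on the original set. -/
structure HasEntireExtension (Ω : Set (CSpace n)) : Prop where
  isOpen : IsOpen Ω
  nonempty : Ω.Nonempty
  extend : ∀ g : CSpace n → CSpace n, DifferentiableOn ℂ g Ω →
    ∃ G : CSpace n → CSpace n, Differentiable ℂ G ∧ EqOn G g Ω
  bound : ∀ K : Set (CSpace n), IsCompact K → ∃ L ⊆ Ω, IsCompact L ∧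
    ∀ G : CSpace n → CSpace n, Differentiable ℂ G →
      ∀ M, (∀ x ∈ L, ‖G x‖ ≤ M) → ∀ x ∈ K, ‖G x‖ ≤ M

theorem hasEntireExtension_posCone {ε : Fin n → ℝ} (hε : ∀ k, |ε k| ≤ 1) {i j : Fin n}
    (hij : i ≠ j) (hi : ε i = 1) (hj : ε j = 1) : HasEntireExtension (posCone ε) where
  isOpen := isOpen_posCone ε
  nonempty := ⟨_, single_mem_posCone hi one_ne_zero⟩
  extend _ hg := exists_entire_extension_posCone hε hij hi hj hg
  bound _ hK := exists_isCompact_posCone_bound hε hi hK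

variable {Ω Ω' : Set (CSpace n)}

/-- Biholomorphic maps extend to biholomorphic maps of the whole space. -/
theorem HasEntireExtension.exists_equiv (h : HasEntireExtension Ω) (h' : HasEntireExtension Ω')
    (e : Ω ≃ Ω') (he : IsHolomorphic e) (he' : IsHolomorphic e.symm) :
    ∃ F : CSpace n ≃ CSpace n, Differentiable ℂ F ∧ Differentiable ℂ F.symm ∧
      ∀ x : Ω, F x = e x := by
  obtain ⟨f, hf, hfe⟩ := he
  obtain ⟨g, hg, hge⟩ := he'
  obtain ⟨F, hF, hFf⟩ := h.extend f hf
  obtain ⟨G, hG, hGg⟩ := h'.extend g hg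
  have hFe : ∀ x : Ω, F x = e x := fun x => (hFf x.2).trans (hfe x)
  have hGe : ∀ x : Ω', G x = e.symm x := fun x => (hGg x.2).trans (hge x)
  have hGF : G ∘ F = id := entire_eq_of_eqOn (hG.comp hF) differentiable_id h.isOpen h.nonempty
    fun x hx => by
      rw [Function.comp_apply, hFe ⟨x, hx⟩, hGe, Equiv.symm_apply_apply]; rfl
  have hFG : F ∘ G = id := entire_eq_of_eqOn (hF.comp hG) differentiable_id h'.isOpen h'.nonempty
    fun x hx => by
      rw [Function.comp_apply, hGe ⟨x, hx⟩, hFe, Equiv.apply_symm_apply]; rfl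
  exact ⟨⟨F, G, congrFun hGF, congrFun hFG⟩, hF, hG, hFe⟩

theorem apply_mem_iff_of_extends {F : CSpace n ≃ CSpace n} {e : Ω ≃ Ω'} (h : ∀ x : Ω, F x = e x)
    (x : CSpace n) : F x ∈ Ω' ↔ x ∈ Ω := by
  refine ⟨fun hx => ?_, fun hx => by rw [h ⟨x, hx⟩]; exact (e _).2⟩
  have : F (e.symm ⟨F x, hx⟩) = F x := by rw [h, Equiv.apply_symm_apply]
  rw [← F.injective this]
  exact (e.symm _).2

theorem apply_mem_interior_compl_iff {F : CSpace n ≃ CSpace n} (hF : Continuous F)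
    (hF' : Continuous F.symm) (h : ∀ x, F x ∈ Ω' ↔ x ∈ Ω) (x : CSpace n) :
    F x ∈ interior Ω'ᶜ ↔ x ∈ interior Ωᶜ := by
  have h1 := (Homeomorph.mk F hF hF').preimage_interior Ω'ᶜ
  have h2 : F ⁻¹' Ω'ᶜ = Ωᶜ := Set.ext fun y => not_congr (h y)
  change F ⁻¹' interior Ω'ᶜ = interior (F ⁻¹' Ω'ᶜ) at h1
  rw [h2] at h1
  rw [← h1]
  rfl

/-- The biholomorphic map of the whole space that extends a given automorphism. -/
noncomputable def HasEntireExtension.global (h : HasEntireExtension Ω) (f : Aut Ω) :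
    CSpace n ≃ CSpace n :=
  (h.exists_equiv h f.1 f.2.1 f.2.2).choose

theorem HasEntireExtension.differentiable_global (h : HasEntireExtension Ω) (f : Aut Ω) :
    Differentiable ℂ (h.global f) :=
  (h.exists_equiv h f.1 f.2.1 f.2.2).choose_spec.1

theorem HasEntireExtension.differentiable_global_symm (h : HasEntireExtension Ω) (f : Aut Ω) :
    Differentiable ℂ (h.global f).symm :=
  (h.exists_equiv h f.1 f.2.1 f.2.2).choose_spec.2.1

theorem HasEntireExtension.global_apply (h : HasEntireExtension Ω) (f : Aut Ω) (x : Ω) :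
    h.global f x = f.1 x :=
  (h.exists_equiv h f.1 f.2.1 f.2.2).choose_spec.2.2 x

theorem HasEntireExtension.global_eq (h : HasEntireExtension Ω) (f : Aut Ω)
    {F : CSpace n ≃ CSpace n} (hF : Differentiable ℂ F) (hFf : ∀ x : Ω, F x = f.1 x) :
    h.global f = F :=
  Equiv.coe_fn_injective (entire_eq_of_eqOn (h.differentiable_global f) hF h.isOpen h.nonempty
    fun x hx => (h.global_apply f ⟨x, hx⟩).trans (hFf ⟨x, hx⟩).symm)

theorem HasEntireExtension.global_mul (h : HasEntireExtension Ω) (f g : Aut Ω) :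
    h.global (f * g) = (h.global g).trans (h.global f) :=
  h.global_eq _ ((h.differentiable_global f).comp (h.differentiable_global g)) fun x => by
    rw [Equiv.trans_apply, h.global_apply, h.global_apply]; rfl

theorem HasEntireExtension.global_mem_iff (h : HasEntireExtension Ω) (hc : Ω' = interior Ωᶜ)
    (f : Aut Ω) (x : CSpace n) : h.global f x ∈ Ω' ↔ x ∈ Ω' := by
  rw [hc]
  exact apply_mem_interior_compl_iff (h.differentiable_global f).continuous
    (h.differentiable_global_symm f).continuous (apply_mem_iff_of_extends (h.global_apply f)) x

/-- The automorphism induced on the exterior by the extension of an automorphism. -/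
noncomputable def HasEntireExtension.transfer (h : HasEntireExtension Ω) (hc : Ω' = interior Ωᶜ)
    (f : Aut Ω) : Aut Ω' :=
  ⟨(h.global f).subtypeEquiv fun x => (h.global_mem_iff hc f x).symm,
    ⟨h.global f, (h.differentiable_global f).differentiableOn, fun _ => rfl⟩,
    ⟨(h.global f).symm, (h.differentiable_global_symm f).differentiableOn, fun _ => rfl⟩⟩

theorem HasEntireExtension.transfer_apply (h : HasEntireExtension Ω) (hc : Ω' = interior Ωᶜ)
    (f : Aut Ω) (x : Ω') : ((h.transfer hc f).1 x : CSpace n) = h.global f x := rfl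

theorem HasEntireExtension.transfer_mul (h : HasEntireExtension Ω) (hc : Ω' = interior Ωᶜ)
    (f g : Aut Ω) : h.transfer hc (f * g) = h.transfer hc f * h.transfer hc g := by
  refine Subtype.ext (Equiv.ext fun x => Subtype.ext ?_)
  rw [h.transfer_apply, h.global_mul]
  rfl

/-- By uniqueness of extensions, `h.global f` also extends the transferred automorphism, so
transferring back restricts the same entire map to `Ω`. -/
theorem HasEntireExtension.transfer_transfer (h : HasEntireExtension Ω)
    (h' : HasEntireExtension Ω') (hc : Ω' = interior Ωᶜ) (hc' : Ω = interior Ω'ᶜ) (f : Aut Ω) :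
    h'.transfer hc' (h.transfer hc f) = f := by
  refine Subtype.ext (Equiv.ext fun x => Subtype.ext ?_)
  rw [h'.transfer_apply, h'.global_eq (h.transfer hc f) (h.differentiable_global f) fun _ => rfl,
    h.global_apply]

/-- The difference of two extensions is entire, so on a compact subset of `Ω'` it is bounded by its
values on a compact `L ⊆ Ω`, where closeness is given. -/
theorem HasEntireExtension.continuous_transfer (h : HasEntireExtension Ω)
    (hc : Ω' = interior Ωᶜ) : Continuous (h.transfer hc) := by
  refine continuous_induced_rng.2 (continuous_iff_continuousAt.2 fun f₀ => ?_)
  rw [ContinuousAt, ContinuousMap.tendsto_iff_forall_isCompact_tendstoUniformlyOn]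
  intro K hK
  obtain ⟨L, hLΩ, hL, hbound⟩ := h.bound _ (hK.image continuous_subtype_val)
  have hL' : IsCompact ((↑) ⁻¹' L : Set Ω) :=
    Topology.IsInducing.subtypeVal.isCompact_preimage_iff (by simpa using hLΩ) |>.2 hL
  have hcont : Continuous (Aut.toContinuousMap : Aut Ω → C(Ω, Ω)) := continuous_induced_dom
  have h1 := ContinuousMap.tendsto_iff_forall_isCompact_tendstoUniformlyOn.1
    (hcont.tendsto f₀) _ hL'
  rw [Metric.tendstoUniformlyOn_iff] at h1 ⊢
  intro δ hδ
  filter_upwards [h1 (δ / 2) (half_pos hδ)] with f hf x hx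
  have h2 := hbound (fun y => h.global f₀ y - h.global f y)
    ((h.differentiable_global f₀).sub (h.differentiable_global f)) (δ / 2) (fun y hy => by
      have := hf ⟨y, hLΩ hy⟩ hy
      rw [Subtype.dist_eq, dist_eq_norm] at this
      rw [h.global_apply f₀ ⟨y, hLΩ hy⟩, h.global_apply f ⟨y, hLΩ hy⟩]
      exact this.le) x ⟨x, hx, rfl⟩
  rw [Subtype.dist_eq, dist_eq_norm]
  exact h2.trans_lt (half_lt_self hδ)

/-- The automorphism groups of a set and of its exterior are isomorphic as topological groups. -/
noncomputable def HasEntireExtension.transferEquiv (h : HasEntireExtension Ω)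
    (h' : HasEntireExtension Ω') (hc : Ω' = interior Ωᶜ) (hc' : Ω = interior Ω'ᶜ) :
    Aut Ω ≃ₜ* Aut Ω' where
  toFun := h.transfer hc
  invFun := h'.transfer hc'
  left_inv := h.transfer_transfer h' hc hc'
  right_inv := h'.transfer_transfer h hc' hc
  map_mul' := h.transfer_mul hc
  continuous_toFun := h.continuous_transfer hc
  continuous_invFun := h'.continuous_transfer hc'

end GlobalExtension

/-! ### Transitivity by scalings and quasi-reflections -/

section Homogeneity

variable {n : ℕ}

/-- The sesquilinear form that polarizes `signedForm ε`. -/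
noncomputable def signedInner (ε : Fin n → ℝ) (x y : CSpace n) : ℂ :=
  ∑ k, (ε k : ℂ) * (x k * (starRingEnd ℂ) (y k))

theorem signedInner_self (ε : Fin n → ℝ) (x : CSpace n) :
    signedInner ε x x = (signedForm ε x : ℂ) := by
  simp only [signedInner, signedForm, Complex.mul_conj']
  push_cast
  rfl

theorem conj_signedInner (ε : Fin n → ℝ) (x y : CSpace n) :
    (starRingEnd ℂ) (signedInner ε x y) = signedInner ε y x := by
  simp only [signedInner, map_sum, map_mul, Complex.conj_ofReal, Complex.conj_conj]
  exact Finset.sum_congr rfl fun k _ => by ring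

theorem signedInner_sub_left (ε : Fin n → ℝ) (x y z : CSpace n) :
    signedInner ε (x - y) z = signedInner ε x z - signedInner ε y z := by
  simp only [signedInner, ← Finset.sum_sub_distrib, PiLp.sub_apply]
  exact Finset.sum_congr rfl fun k _ => by ring

theorem signedInner_smul_left (ε : Fin n → ℝ) (c : ℂ) (x y : CSpace n) :
    signedInner ε (c • x) y = c * signedInner ε x y := by
  simp only [signedInner, Finset.mul_sum, PiLp.smul_apply, smul_eq_mul]
  exact Finset.sum_congr rfl fun k _ => by ring

theorem signedInner_sub_right (ε : Fin n → ℝ) (x y z : CSpace n) :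
    signedInner ε x (y - z) = signedInner ε x y - signedInner ε x z := by
  rw [← conj_signedInner, signedInner_sub_left, map_sub, conj_signedInner, conj_signedInner]

theorem signedInner_smul_right (ε : Fin n → ℝ) (c : ℂ) (x y : CSpace n) :
    signedInner ε x (c • y) = (starRingEnd ℂ) c * signedInner ε x y := by
  rw [← conj_signedInner, signedInner_smul_left, map_mul, conj_signedInner]

/-- The quasi-reflection along `x - y`, which takes `x` to `y`. -/
noncomputable def quasiReflection (ε : Fin n → ℝ) (x y v : CSpace n) : CSpace n :=
  v - (signedInner ε v (x - y) / signedInner ε x (x - y)) • (x - y)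

theorem differentiable_quasiReflection (ε : Fin n → ℝ) (x y : CSpace n) :
    Differentiable ℂ (quasiReflection ε x y) := by
  have : Differentiable ℂ fun v => signedInner ε v (x - y) := by
    unfold signedInner
    have h : ∀ k, Differentiable ℂ fun v : CSpace n => v k := fun k =>
      (EuclideanSpace.proj (𝕜 := ℂ) k).differentiable
    exact Differentiable.fun_sum fun k _ => ((h k).mul_const _).const_mul _
  unfold quasiReflection
  fun_prop

theorem quasiReflection_apply {ε : Fin n → ℝ} {x y : CSpace n}
    (h : signedInner ε x (x - y) ≠ 0) : quasiReflection ε x y x = y := by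
  rw [quasiReflection, div_self h, one_smul, sub_sub_cancel]

theorem quasiReflection_quasiReflection {ε : Fin n → ℝ} {x y : CSpace n}
    (h : signedInner ε x (x - y) ≠ 0) (h' : signedInner ε y (y - x) ≠ 0) (v : CSpace n) :
    quasiReflection ε y x (quasiReflection ε x y v) = v := by
  -- The second map uses the same coefficient along the opposite vector, so the two corrections
  -- cancel.
  have key : signedInner ε (quasiReflection ε x y v) (y - x) / signedInner ε y (y - x) =
      signedInner ε v (x - y) / signedInner ε x (x - y) := by
    rw [div_eq_iff h']
    simp only [quasiReflection, signedInner_sub_left, signedInner_smul_left,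
      signedInner_sub_right] at h h' ⊢
    field_simp
    ring
  rw [quasiReflection, key, quasiReflection]
  module

/-- With `u = x - y`, equality of the two form values gives `⟨u, u⟩ = 2 Re ⟨x, u⟩`, which is exactly
what cancels the cross terms against the quadratic one. -/
theorem signedForm_quasiReflection {ε : Fin n → ℝ} {x y : CSpace n}
    (h : signedInner ε x (x - y) ≠ 0) (hxy : signedForm ε x = signedForm ε y) (v : CSpace n) :
    signedForm ε (quasiReflection ε x y v) = signedForm ε v := by
  have hc := (map_ne_zero (starRingEnd ℂ)).2 h
  have hs : signedInner ε x x = signedInner ε y y := by simp only [signedInner_self, hxy]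
  rw [← Complex.ofReal_inj, ← signedInner_self, ← signedInner_self]
  simp only [quasiReflection, signedInner_sub_left, signedInner_smul_left, signedInner_sub_right,
    signedInner_smul_right, map_div₀, map_sub, conj_signedInner] at h hc ⊢
  rw [hs] at h hc ⊢
  field_simp
  ring

/-- Two points are related if a biholomorphic map of the space that preserves `Ω` takes the first
one to the second one. -/
def GloballyRelated (Ω : Set (CSpace n)) (x y : CSpace n) : Prop :=
  ∃ F : CSpace n ≃ CSpace n, Differentiable ℂ F ∧ Differentiable ℂ F.symm ∧
    (∀ z, z ∈ Ω ↔ F z ∈ Ω) ∧ F x = y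

theorem GloballyRelated.trans {Ω : Set (CSpace n)} {x y z : CSpace n}
    (h : GloballyRelated Ω x y) (h' : GloballyRelated Ω y z) : GloballyRelated Ω x z := by
  obtain ⟨F, hF, hF', hFΩ, rfl⟩ := h
  obtain ⟨G, hG, hG', hGΩ, rfl⟩ := h'
  exact ⟨F.trans G, hG.comp hF, hF'.comp hG', fun z => (hFΩ z).trans (hGΩ _), rfl⟩

theorem isHomogeneous_of_globallyRelated {Ω : Set (CSpace n)}
    (h : ∀ x ∈ Ω, ∀ y ∈ Ω, GloballyRelated Ω x y) : IsHomogeneous Ω := by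
  intro x y
  obtain ⟨F, hF, hF', hFΩ, hxy⟩ := h x x.2 y y.2
  exact ⟨F.subtypeEquiv hFΩ, ⟨⟨F, hF.differentiableOn, fun _ => rfl⟩,
    ⟨F.symm, hF'.differentiableOn, fun _ => rfl⟩⟩, Subtype.ext hxy⟩

theorem globallyRelated_smul (ε : Fin n → ℝ) {c : ℂ} (hc : c ≠ 0) (x : CSpace n) :
    GloballyRelated (posCone ε) x (c • x) := by
  refine ⟨(LinearEquiv.smulOfNeZero ℂ (CSpace n) c hc).toEquiv, ?_, ?_, fun z => ?_, rfl⟩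
  · change Differentiable ℂ fun z : CSpace n => c • z
    fun_prop
  · change Differentiable ℂ fun z : CSpace n => (Units.mk0 c hc)⁻¹ • z
    fun_prop
  · change 0 < signedForm ε z ↔ 0 < signedForm ε (c • z)
    rw [signedForm_smul, mul_pos_iff_of_pos_left (by positivity)]

theorem globallyRelated_of_signedInner_ne {ε : Fin n → ℝ} {x y : CSpace n}
    (hxy : signedForm ε x = signedForm ε y) (h : signedInner ε x y ≠ signedForm ε x) :
    GloballyRelated (posCone ε) x y := by
  have h1 : signedInner ε x (x - y) ≠ 0 := by
    rw [signedInner_sub_right, signedInner_self]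
    exact sub_ne_zero.2 h.symm
  have h2 : signedInner ε y (y - x) ≠ 0 := by
    rw [signedInner_sub_right, signedInner_self]
    refine sub_ne_zero.2 fun h' => h ?_
    rw [← conj_signedInner, ← h', Complex.conj_ofReal, hxy]
  refine ⟨⟨quasiReflection ε x y, quasiReflection ε y x, quasiReflection_quasiReflection h1 h2,
    quasiReflection_quasiReflection h2 h1⟩, differentiable_quasiReflection ε x y,
    differentiable_quasiReflection ε y x, fun z => ?_, quasiReflection_apply h1⟩
  change 0 < signedForm ε z ↔ 0 < signedForm ε (quasiReflection ε x y z)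
  rw [signedForm_quasiReflection h1 hxy]

theorem isHomogeneous_posCone (ε : Fin n → ℝ) : IsHomogeneous (posCone ε) := by
  refine isHomogeneous_of_globallyRelated fun x hx y hy => ?_
  have hx : 0 < signedForm ε x := hx
  have hy : 0 < signedForm ε y := hy
  have hc : 0 < √(signedForm ε y / signedForm ε x) := Real.sqrt_pos.2 (by positivity)
  refine (globallyRelated_smul ε
    (c := ((√(signedForm ε y / signedForm ε x) : ℝ) : ℂ)) (by exact_mod_cast hc.ne') x).trans ?_
  set x' := ((√(signedForm ε y / signedForm ε x) : ℝ) : ℂ) • x with hx'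
  have hform : signedForm ε x' = signedForm ε y := by
    rw [hx', signedForm_smul, Complex.norm_real, Real.norm_of_nonneg hc.le,
      Real.sq_sqrt (by positivity), div_mul_cancel₀ _ hx.ne']
  -- In this case the quasi-reflection from `x'` to `y` is undefined, but the one to `-y` exists
  -- because the form is positive at `y`; a scaling by `-1` finishes.
  by_cases h : signedInner ε x' y = signedForm ε x'
  · have h1 : GloballyRelated (posCone ε) x' ((-1 : ℂ) • y) := by
      refine globallyRelated_of_signedInner_ne ?_ ?_
      · rw [signedForm_smul ε (-1) y, norm_neg, norm_one, one_pow, one_mul, hform]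
      · rw [signedInner_smul_right, h, hform]
        intro h2
        simp only [map_neg, map_one, neg_mul, one_mul] at h2
        have h3 : -signedForm ε y = signedForm ε y := by exact_mod_cast h2
        linarith
    simpa using h1.trans (globallyRelated_smul ε (by norm_num : (-1 : ℂ) ≠ 0) _)
  · exact globallyRelated_of_signedInner_ne hform h

end Homogeneity

/-! ### Connectedness and unboundedness of the cone -/

section Connectedness

variable {n : ℕ}

/-- The subspace of the points whose coordinates vanish off `S`. -/
def coordSubspace (S : Set (Fin n)) : Submodule ℂ (CSpace n) where
  carrier := {x | ∀ k ∉ S, x k = 0}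
  add_mem' hx hy k hk := by simp [hx k hk, hy k hk]
  zero_mem' k _ := by simp
  smul_mem' c x hx k hk := by simp [hx k hk]

theorem signedForm_add_of_mem {ε : Fin n → ℝ} (hε : ∀ k, ε k = 1 ∨ ε k = -1) {z w : CSpace n}
    (hz : z ∈ coordSubspace {k | ε k = 1}) (hw : w ∈ coordSubspace {k | ε k = 1}ᶜ) :
    signedForm ε (z + w) = ‖z‖ ^ 2 - ‖w‖ ^ 2 := by
  rw [EuclideanSpace.norm_sq_eq, EuclideanSpace.norm_sq_eq, ← Finset.sum_sub_distrib]
  refine Finset.sum_congr rfl fun k _ => ?_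
  rcases hε k with h | h
  · have : w k = 0 := hw k (by simp [h])
    simp [h, this]
  · have : z k = 0 := hz k (by simp [h]; norm_num)
    simp [h, this]

/-- The cone is the continuous image, under `(z, w) ↦ z + ‖z‖ w`, of the punctured positive subspace
times the unit ball of the negative one. The first factor is connected because its real dimension is
at least two. -/
theorem isConnected_posCone {ε : Fin n → ℝ} (hε : ∀ k, ε k = 1 ∨ ε k = -1) {i : Fin n}
    (hi : ε i = 1) : IsConnected (posCone ε) := by
  have : Nontrivial (coordSubspace {k | ε k = 1}) := by
    refine ⟨⟨⟨EuclideanSpace.single i 1, fun k hk => ?_⟩, 0, fun h => ?_⟩⟩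
    · have : k ≠ i := fun h => hk (by rw [h]; exact hi)
      simp [this]
    · have := congrArg (fun v : coordSubspace {k | ε k = 1} => (v : CSpace n) i) h
      simp at this
  have hrank : 1 < Module.rank ℝ (coordSubspace {k | ε k = 1}) := by
    rw [rank_real_of_complex]
    have : (1 : Cardinal) ≤ Module.rank ℂ (coordSubspace {k | ε k = 1}) :=
      Cardinal.one_le_iff_pos.2 rank_pos
    calc (1 : Cardinal) < 2 * 1 := by norm_num
      _ ≤ _ := by gcongr
  have hconn : IsConnected (({0}ᶜ : Set (coordSubspace {k | ε k = 1})) ×ˢ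
      ball (0 : coordSubspace {k | ε k = 1}ᶜ) 1) :=
    (isConnected_compl_singleton_of_one_lt_rank hrank 0).prod
      ((convex_ball _ _).isPathConnected ⟨0, by simp⟩).isConnected
  have himage : posCone ε = (fun p : coordSubspace {k | ε k = 1} × coordSubspace {k | ε k = 1}ᶜ =>
      (p.1 : CSpace n) + ((‖p.1‖ : ℝ) : ℂ) • (p.2 : CSpace n)) '' ({0}ᶜ ×ˢ ball 0 1) := by
    ext x
    constructor
    · intro hx
      have hx : 0 < signedForm ε x := hx
      classical
      obtain ⟨z, w, hxzw⟩ : ∃ (z : coordSubspace {k | ε k = 1})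
          (w : coordSubspace {k | ε k = 1}ᶜ), (z : CSpace n) + w = x := by
        refine ⟨⟨WithLp.toLp 2 fun k => if ε k = 1 then x k else 0, fun k hk => ?_⟩,
          ⟨WithLp.toLp 2 fun k => if ε k = 1 then 0 else x k, fun k hk => ?_⟩, ?_⟩
        · exact if_neg hk
        · exact if_pos (not_not.1 hk)
        · ext k
          by_cases h : ε k = 1 <;> simp [h]
      rw [← hxzw, signedForm_add_of_mem hε z.2 w.2] at hx
      have hwz : ‖w‖ < ‖z‖ := lt_of_pow_lt_pow_left₀ 2 (norm_nonneg _) (sub_pos.1 hx)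
      have hz : 0 < ‖z‖ := (norm_nonneg _).trans_lt hwz
      refine ⟨(z, ((‖z‖ : ℝ) : ℂ)⁻¹ • w), ⟨norm_pos_iff.1 hz, ?_⟩, ?_⟩
      · simp only [mem_ball_zero_iff, norm_smul, norm_inv, Complex.norm_real, norm_norm]
        rwa [inv_mul_lt_one₀ hz]
      · have hz' : ((‖z‖ : ℝ) : ℂ) ≠ 0 := by exact_mod_cast hz.ne'
        simp only [Submodule.coe_smul]
        rw [smul_inv_smul₀ hz', hxzw]
    · rintro ⟨⟨z, w⟩, ⟨hz, hw⟩, rfl⟩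
      have hz : 0 < ‖z‖ := norm_pos_iff.2 hz
      have hw : ‖w‖ < 1 := by simpa using hw
      change 0 < signedForm ε _
      rw [signedForm_add_of_mem hε z.2 (Submodule.smul_mem _ _ w.2), norm_smul, Complex.norm_real,
        norm_norm, sub_pos]
      refine pow_lt_pow_left₀ ?_ (by positivity) two_ne_zero
      exact mul_lt_of_lt_one_right hz hw
  rw [himage]
  exact hconn.image _ (by fun_prop)

theorem not_isBounded_posCone {ε : Fin n → ℝ} {i : Fin n} (hi : ε i = 1) :
    ¬ Bornology.IsBounded (posCone ε) := by
  intro h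
  obtain ⟨r, hr, hsub⟩ := h.subset_closedBall_lt 0 0
  have h1 := hsub (single_mem_posCone hi (c := ((r + 1 : ℝ) : ℂ))
    (by exact_mod_cast (by positivity : r + 1 ≠ 0)))
  have h2 := PiLp.norm_apply_le (setCoord i (0 : CSpace n) ((r + 1 : ℝ) : ℂ)) i
  rw [setCoord_same, Complex.norm_real, Real.norm_of_nonneg (by positivity)] at h2
  rw [mem_closedBall_zero_iff] at h1
  linarith

theorem isUnboundedHomogeneousDomain_posCone {ε : Fin n → ℝ} (hε : ∀ k, ε k = 1 ∨ ε k = -1)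
    {i : Fin n} (hi : ε i = 1) : IsUnboundedHomogeneousDomain (posCone ε) :=
  ⟨⟨isOpen_posCone ε, isConnected_posCone hε hi⟩, not_isBounded_posCone hi,
    isHomogeneous_posCone ε⟩

end Connectedness

/-! ### Comparison of indices of inertia -/

section Inequivalence

variable {n : ℕ}

/-- For `x` in the cone, the form along `t ↦ F (t x)`, `t` real, is maximal at `t = 0`, so the
differential of the form at `F 0` kills `L x`. Vectors of an open cone span, `L` is onto and the
form is nondegenerate, which forces `F 0 = 0`. -/
theorem eq_zero_of_maps_posCone {ε : Fin n → ℝ} (hε : ∀ k, ε k = 1 ∨ ε k = -1) {i : Fin n}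
    (hi : ε i = 1) {F : CSpace n → CSpace n} {L : CSpace n →L[ℂ] CSpace n}
    (hL : Function.Surjective L) (hF : HasFDerivAt F L 0) (h0 : signedForm ε (F 0) = 0)
    (h : ∀ x ∈ posCone ε, signedForm ε (F x) ≤ 0) : F 0 = 0 := by
  -- Half the real differential of the form at `F 0`.
  set ℓ : CSpace n → ℝ := fun v => ∑ k, ε k * inner ℝ (F 0 k) (v k) with hℓ
  have hadd : ∀ (v w : CSpace n) (t : ℝ), ℓ (v + (t : ℂ) • w) = ℓ v + t * ℓ w := by
    intro v w t
    simp only [hℓ, Finset.mul_sum, ← Finset.sum_add_distrib]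
    refine Finset.sum_congr rfl fun k _ => ?_
    simp only [PiLp.add_apply, PiLp.smul_apply, inner_add_right, smul_eq_mul,
      ← Complex.real_smul, inner_smul_right]
    ring
  have hcone : ∀ x ∈ posCone ε, ℓ (L x) = 0 := by
    intro x hx
    have hlineC : HasDerivAt (fun t : ℂ => F (t • x)) (L x) ((0 : ℝ) : ℂ) := by
      have h1 : HasDerivAt (fun t : ℂ => t • x) x ((0 : ℝ) : ℂ) := by
        simpa using (hasDerivAt_id ((0 : ℝ) : ℂ)).smul_const x
      have h2 : HasFDerivAt F L (((0 : ℝ) : ℂ) • x) := by simpa using hF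
      exact h2.comp_hasDerivAt _ h1
    have hline : HasDerivAt (fun t : ℝ => F ((t : ℂ) • x)) (L x) 0 := by
      have h1 := hlineC.scomp (0 : ℝ) Complex.ofRealCLM.hasDerivAt
      rw [Complex.ofRealCLM_apply, Complex.ofReal_one, one_smul] at h1
      exact h1
    have hcoord : ∀ k, HasDerivAt (fun t : ℝ => F ((t : ℂ) • x) k) (L x k) 0 := fun k =>
      (((EuclideanSpace.proj (𝕜 := ℂ) k).restrictScalars ℝ).hasFDerivAt).comp_hasDerivAt 0 hline
    have hder : HasDerivAt (fun t : ℝ => signedForm ε (F ((t : ℂ) • x))) (2 * ℓ (L x)) 0 := by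
      have := HasDerivAt.fun_sum (u := Finset.univ)
        fun k _ => ((hcoord k).norm_sq).const_mul (ε k)
      refine this.congr_deriv ?_
      rw [hℓ, Finset.mul_sum]
      refine Finset.sum_congr rfl fun k _ => ?_
      simp
      ring
    have hmax : IsLocalMax (fun t : ℝ => signedForm ε (F ((t : ℂ) • x))) 0 := by
      refine Eventually.of_forall fun t => ?_
      simp only [Complex.ofReal_zero, zero_smul, h0]
      by_cases ht : t = 0
      · simp [ht, h0]
      · refine h _ ?_
        have hx : 0 < signedForm ε x := hx
        change 0 < signedForm ε _
        rw [signedForm_smul]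
        have : 0 < ‖(t : ℂ)‖ := by simpa using ht
        positivity
    have := hmax.hasDerivAt_eq_zero hder
    linarith
  have hall : ∀ v, ℓ (L v) = 0 := by
    intro v
    have hx := single_mem_posCone hi (one_ne_zero (α := ℂ))
    have hc : Continuous fun t : ℝ => setCoord i 0 1 + (t : ℂ) • v := by fun_prop
    have hev : ∀ᶠ t : ℝ in 𝓝 0, setCoord i 0 1 + (t : ℂ) • v ∈ posCone ε :=
      hc.continuousAt.eventually_mem ((isOpen_posCone ε).mem_nhds (by simpa using hx))
    obtain ⟨t, ht, ht0⟩ := ((hev.filter_mono nhdsWithin_le_nhds).and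
      (self_mem_nhdsWithin : ∀ᶠ t : ℝ in 𝓝[>] 0, t ∈ Ioi 0)).exists
    have h1 := hcone _ ht
    rw [map_add, map_smul, hadd, hcone _ hx, zero_add] at h1
    exact (mul_eq_zero.1 h1).resolve_left (ne_of_gt ht0)
  ext k
  obtain ⟨v, hv⟩ := hL (setCoord k 0 (F 0 k))
  have h1 := hall v
  rw [hv, hℓ] at h1
  change ∑ m, ε m * inner ℝ (F 0 m) (setCoord k 0 (F 0 k) m) = 0 at h1
  rw [Finset.sum_eq_single k (fun m _ hm => by rw [setCoord_ne hm]; simp) (by simp),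
    setCoord_same, real_inner_self_eq_norm_sq] at h1
  rcases hε k with hk | hk <;> simpa [hk] using h1

/-- `L x` is the limit of `t⁻¹ F (t x)`, and scaling does not change the sign of the form. -/
theorem signedForm_fderiv_nonpos {ε : Fin n → ℝ} {F : CSpace n → CSpace n}
    {L : CSpace n →L[ℂ] CSpace n} (hF : HasFDerivAt F L 0) (h0 : F 0 = 0)
    (h : ∀ x ∈ posCone ε, signedForm ε (F x) ≤ 0) {x : CSpace n} (hx : x ∈ posCone ε) :
    signedForm ε (L x) ≤ 0 := by
  have hline : HasDerivAt (fun t : ℂ => F (t • x)) (L x) 0 := by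
    have h1 : HasDerivAt (fun t : ℂ => t • x) x 0 := by
      simpa using (hasDerivAt_id (0 : ℂ)).smul_const x
    have h2 : HasFDerivAt F L ((0 : ℂ) • x) := by simpa using hF
    exact h2.comp_hasDerivAt _ h1
  have ht := ((continuous_signedForm ε).tendsto _).comp (hasDerivAt_iff_tendsto_slope.1 hline)
  refine le_of_tendsto ht ?_
  filter_upwards [self_mem_nhdsWithin] with t ht0
  have ht0 : t ≠ 0 := ht0
  simp only [Function.comp_apply, slope_def_module, zero_smul, h0, sub_zero, signedForm_smul]
  refine mul_nonpos_of_nonneg_of_nonpos (by positivity) (h _ ?_)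
  have hx : 0 < signedForm ε x := hx
  change 0 < signedForm ε _
  rw [signedForm_smul]
  positivity

/-- Let `A` include the positive coordinates and `B` project to the others. If `B (L (A v)) = 0`,
then `L (A v)` lies in the positive subspace, where the form is the squared norm; being nonpositive
there forces `A v = 0`. So `B ∘ L ∘ A` is injective. -/
theorem card_pos_le_card_neg {ε : Fin n → ℝ} (hε : ∀ k, ε k = 1 ∨ ε k = -1)
    {L : CSpace n →ₗ[ℂ] CSpace n} (hL : Function.Injective L)
    (h : ∀ x ∈ posCone ε, signedForm ε (L x) ≤ 0) :
    Nat.card {k // ε k = 1} ≤ Nat.card {k // ε k ≠ 1} := by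
  have hform : ∀ x ∈ coordSubspace {k | ε k = 1}, signedForm ε x = ‖x‖ ^ 2 := fun x hx => by
    simpa using signedForm_add_of_mem hε hx (zero_mem _)
  classical
  let A : ({k // ε k = 1} → ℂ) →ₗ[ℂ] CSpace n :=
    (WithLp.linearEquiv 2 ℂ (Fin n → ℂ)).symm.toLinearMap ∘ₗ
      Function.ExtendByZero.linearMap ℂ (Subtype.val : {k // ε k = 1} → Fin n)
  have hA : ∀ v, A v ∈ coordSubspace {k | ε k = 1} := fun v k hk => by
    refine Function.extend_apply' _ _ _ ?_
    rintro ⟨⟨m, hm⟩, rfl⟩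
    exact hk hm
  have hAv : ∀ v (k : {k // ε k = 1}), A v k = v k := fun v k =>
    Subtype.val_injective.extend_apply _ _ _
  let B : CSpace n →ₗ[ℂ] ({k // ε k ≠ 1} → ℂ) :=
    LinearMap.funLeft ℂ ℂ (Subtype.val : {k // ε k ≠ 1} → Fin n) ∘ₗ
      (WithLp.linearEquiv 2 ℂ (Fin n → ℂ)).toLinearMap
  have hinj : Function.Injective (B ∘ₗ L ∘ₗ A) := by
    rw [← LinearMap.ker_eq_bot, LinearMap.ker_eq_bot']
    intro v hv
    have hLA : L (A v) ∈ coordSubspace {k | ε k = 1} := fun k hk => congrFun hv ⟨k, hk⟩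
    have hzero : A v = 0 := by
      by_contra hne
      have hpos : A v ∈ posCone ε := by
        change 0 < signedForm ε _
        rw [hform _ (hA v)]
        have := norm_pos_iff.2 hne
        positivity
      have h1 := h _ hpos
      rw [hform _ hLA] at h1
      have h2 : L (A v) = 0 := norm_eq_zero.1 (pow_eq_zero_iff two_ne_zero |>.1
        (le_antisymm h1 (sq_nonneg _)))
      exact hne (hL (h2.trans L.map_zero.symm))
    funext k
    rw [← hAv v k, hzero]
    rfl
  have := LinearMap.finrank_le_finrank_of_injective hinj
  simpa [Module.finrank_fintype_fun_eq_card, Nat.card_eq_fintype_card] using this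

/-- A biholomorphic map of the space that exchanges the two cones of a form bounds its positive
index of inertia by the negative one. -/
theorem card_pos_le_card_neg_of_equiv {ε : Fin n → ℝ} (hε : ∀ k, ε k = 1 ∨ ε k = -1)
    {i : Fin n} (hi : ε i = 1) {F : CSpace n ≃ CSpace n}
    (hF : Differentiable ℂ F) (hF' : Differentiable ℂ F.symm)
    (hpos : ∀ x, F x ∈ posCone (-ε) ↔ x ∈ posCone ε)
    (hneg : ∀ x, F x ∈ posCone ε ↔ x ∈ posCone (-ε)) :
    Nat.card {k // ε k = 1} ≤ Nat.card {k // ε k ≠ 1} := by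
  have hle : ∀ x ∈ posCone ε, signedForm ε (F x) ≤ 0 := fun x hx => by
    have : 0 < signedForm (-ε) (F x) := (hpos x).2 hx
    rw [signedForm_neg] at this
    linarith
  have hmem : ∀ x, x ∈ posCone (-ε) ↔ signedForm ε x < 0 := fun x => by
    simp only [posCone, mem_ofPred_eq, signedForm_neg, neg_pos]
  -- Exchanging the two open cones, `F` preserves the null set, which contains `0`.
  have h0 : signedForm ε (F 0) = 0 := by
    have hz : signedForm ε (0 : CSpace n) = 0 := by simp [signedForm]
    refine le_antisymm (not_lt.1 fun h => ?_) (not_lt.1 fun h => ?_)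
    · exact lt_irrefl _ (hz ▸ (hmem 0).1 ((hneg 0).1 h))
    · exact lt_irrefl (0 : ℝ) (by
        have : 0 < signedForm ε (0 : CSpace n) := (hpos 0).1 ((hmem _).2 h)
        rwa [hz] at this)
  have hd := (hF 0).hasFDerivAt
  have hd' := (hF' (F 0)).hasFDerivAt
  have hcomp : (fderiv ℂ F.symm (F 0)).comp (fderiv ℂ F 0) = ContinuousLinearMap.id ℂ _ := by
    have h1 := hd'.comp (0 : CSpace n) hd
    rw [F.symm_comp_self] at h1
    exact h1.unique (hasFDerivAt_id _)
  have hinj : Function.Injective (fderiv ℂ F 0) :=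
    Function.LeftInverse.injective (g := fderiv ℂ F.symm (F 0)) fun v => by
      simpa using congrArg (fun T : CSpace n →L[ℂ] CSpace n => T v) hcomp
  have hsurj : Function.Surjective (fderiv ℂ F 0) :=
    LinearMap.injective_iff_surjective (f := (fderiv ℂ F 0 : CSpace n →ₗ[ℂ] CSpace n)).1 hinj
  have hF0 := eq_zero_of_maps_posCone hε hi hsurj hd h0 hle
  exact card_pos_le_card_neg hε (L := (fderiv ℂ F 0 : CSpace n →ₗ[ℂ] CSpace n)) hinj
    fun x hx => signedForm_fderiv_nonpos hd hF0 hle hx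

end Inequivalence

/-! ### The domains of signature (p, q) -/

section Signature

/-- The coefficients of the form of signature `(p, q)`. -/
def signature (p q : ℕ) : Fin (p + q) → ℝ := Fin.addCases (fun _ => 1) (fun _ => -1)

theorem signature_castAdd (p q : ℕ) (i : Fin p) : signature p q (Fin.castAdd q i) = 1 :=
  Fin.addCases_left i

theorem signature_natAdd (p q : ℕ) (j : Fin q) : signature p q (Fin.natAdd p j) = -1 :=
  Fin.addCases_right j

theorem signature_eq (p q : ℕ) (k : Fin (p + q)) : signature p q k = 1 ∨ signature p q k = -1 :=
  Fin.addCases (fun i => Or.inl (signature_castAdd p q i))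
    (fun j => Or.inr (signature_natAdd p q j)) k

theorem hermForm_eq_signedForm (p q : ℕ) (x : CSpace (p + q)) :
    hermForm p q x = signedForm (signature p q) x := by
  simp [hermForm, signedForm, Fin.sum_univ_add, signature_castAdd, signature_natAdd, sub_eq_add_neg]

theorem domD_eq_posCone (p q : ℕ) : domD p q = posCone (signature p q) :=
  Set.ext fun x => by simp only [domD, posCone, mem_ofPred_eq, hermForm_eq_signedForm]

theorem domC_eq_posCone (p q : ℕ) : domC p q = posCone (-signature p q) :=
  Set.ext fun x => by
    simp only [domC, posCone, mem_ofPred_eq, hermForm_eq_signedForm, signedForm_neg, neg_pos]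

theorem card_signature_eq_one (p q : ℕ) : Nat.card {k // signature p q k = 1} = p := by
  classical
  rw [Nat.card_eq_fintype_card, Fintype.card_subtype, Finset.card_filter, Fin.sum_univ_add]
  simp only [signature_castAdd, signature_natAdd]
  norm_num

theorem card_signature_ne_one (p q : ℕ) : Nat.card {k // signature p q k ≠ 1} = q := by
  classical
  rw [Nat.card_eq_fintype_card, Fintype.card_subtype, Finset.card_filter, Fin.sum_univ_add]
  simp only [signature_castAdd, signature_natAdd]
  norm_num

variable {p q : ℕ}

theorem isUnboundedHomogeneousDomain_domD (hp : 1 < p) :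
    IsUnboundedHomogeneousDomain (domD p q) := by
  rw [domD_eq_posCone]
  exact isUnboundedHomogeneousDomain_posCone (signature_eq p q)
    (signature_castAdd p q ⟨0, by omega⟩)

theorem neg_signature_eq (p q : ℕ) (k : Fin (p + q)) :
    (-signature p q) k = 1 ∨ (-signature p q) k = -1 := by
  rcases signature_eq p q k with h | h <;> simp [h]

theorem neg_signature_natAdd (p q : ℕ) (j : Fin q) : (-signature p q) (Fin.natAdd p j) = 1 := by
  simp [signature_natAdd]

theorem isUnboundedHomogeneousDomain_domC (hq : 1 < q) :
    IsUnboundedHomogeneousDomain (domC p q) := by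
  rw [domC_eq_posCone]
  exact isUnboundedHomogeneousDomain_posCone (neg_signature_eq p q)
    (neg_signature_natAdd p q ⟨0, by omega⟩)

theorem abs_le_one_of_eq {n : ℕ} {ε : Fin n → ℝ} (hε : ∀ k, ε k = 1 ∨ ε k = -1) (k : Fin n) :
    |ε k| ≤ 1 := by
  rcases hε k with h | h <;> simp [h]

theorem hasEntireExtension_domD (hp : 1 < p) : HasEntireExtension (domD p q) := by
  rw [domD_eq_posCone]
  exact hasEntireExtension_posCone (abs_le_one_of_eq (signature_eq p q))
    (i := Fin.castAdd q ⟨0, by omega⟩) (j := Fin.castAdd q ⟨1, hp⟩) (by simp [Fin.ext_iff])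
    (signature_castAdd p q _) (signature_castAdd p q _)

theorem hasEntireExtension_domC (hq : 1 < q) : HasEntireExtension (domC p q) := by
  rw [domC_eq_posCone]
  exact hasEntireExtension_posCone (abs_le_one_of_eq (neg_signature_eq p q))
    (i := Fin.natAdd p ⟨0, by omega⟩) (j := Fin.natAdd p ⟨1, hq⟩) (by simp [Fin.ext_iff])
    (neg_signature_natAdd p q _) (neg_signature_natAdd p q _)

theorem domC_eq_interior_compl (hp : 1 < p) : domC p q = interior (domD p q)ᶜ := by
  rw [domC_eq_posCone, domD_eq_posCone]
  exact posCone_neg_eq_interior_compl (signature_castAdd p q ⟨0, by omega⟩)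

theorem domD_eq_interior_compl (hq : 1 < q) : domD p q = interior (domC p q)ᶜ := by
  have := posCone_neg_eq_interior_compl (neg_signature_natAdd p q ⟨0, by omega⟩)
  rwa [neg_neg, ← domC_eq_posCone, ← domD_eq_posCone] at this

theorem not_biholomorphic_domD_domC (hp : 1 < p) (hq : 1 < q) (hpq : p ≠ q) :
    ¬ Biholomorphic (domD p q) (domC p q) := by
  rintro ⟨e, he, he'⟩
  obtain ⟨F, hF, hF', hFe⟩ :=
    (hasEntireExtension_domD hp).exists_equiv (hasEntireExtension_domC hq) e he he'
  have hpos : ∀ x, F x ∈ domC p q ↔ x ∈ domD p q := apply_mem_iff_of_extends hFe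
  have hneg : ∀ x, F x ∈ domD p q ↔ x ∈ domC p q := by
    rw [domD_eq_interior_compl hq]
    nth_rewrite 2 [domC_eq_interior_compl hp]
    exact apply_mem_interior_compl_iff hF.continuous hF'.continuous hpos
  rw [domD_eq_posCone, domC_eq_posCone] at hpos hneg
  have h1 := card_pos_le_card_neg_of_equiv (signature_eq p q)
    (signature_castAdd p q ⟨0, by omega⟩) hF hF' hpos hneg
  -- The same map, read with the opposite form, gives the reverse inequality.
  have h2 := card_pos_le_card_neg_of_equiv (neg_signature_eq p q)
    (neg_signature_natAdd p q ⟨0, by omega⟩) hF hF'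
    (by simpa using hneg) (by simpa using hpos)
  rw [card_signature_eq_one, card_signature_ne_one] at h1
  have h3 : ∀ k, (-signature p q) k = 1 ↔ signature p q k ≠ 1 := fun k => by
    rcases signature_eq p q k with h | h <;> simp [h] <;> norm_num
  have h4 : ∀ k, (-signature p q) k ≠ 1 ↔ signature p q k = 1 := fun k => by
    rw [← not_iff_not, not_not, h3]
  simp only [h3, h4] at h2
  simp only [card_signature_eq_one, card_signature_ne_one] at h2
  exact hpq (le_antisymm h1 (by simpa [card_signature_eq_one] using h2))

end Signature

end HolomorphicDomain

theorem theorem6 :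
    (∀ n : ℕ, 5 ≤ n →
      ∃ Ω₁ Ω₂ : Set (HolomorphicDomain.CSpace n),
        HolomorphicDomain.IsUnboundedHomogeneousDomain Ω₁ ∧
        HolomorphicDomain.IsUnboundedHomogeneousDomain Ω₂ ∧
        ¬ HolomorphicDomain.Biholomorphic Ω₁ Ω₂ ∧
        Nonempty (HolomorphicDomain.Aut Ω₁ ≃ₜ* HolomorphicDomain.Aut Ω₂)) ∧
    (∀ p q : ℕ, 1 < p → 1 < q → p ≠ q →
      HolomorphicDomain.IsUnboundedHomogeneousDomain (HolomorphicDomain.domD p q) ∧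
      HolomorphicDomain.IsUnboundedHomogeneousDomain (HolomorphicDomain.domC p q) ∧
      ¬ HolomorphicDomain.Biholomorphic
          (HolomorphicDomain.domD p q) (HolomorphicDomain.domC p q) ∧
      ∃ φ : HolomorphicDomain.Aut (HolomorphicDomain.domD p q) ≃ₜ*
          HolomorphicDomain.Aut (HolomorphicDomain.domC p q),
        ∀ f : HolomorphicDomain.Aut (HolomorphicDomain.domD p q),
          ∃ F : HolomorphicDomain.CSpace (p + q) ≃ HolomorphicDomain.CSpace (p + q),
            Differentiable ℂ F ∧ Differentiable ℂ F.symm ∧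
            (∀ x : HolomorphicDomain.domD p q, F x = f.1 x) ∧
            (∀ x : HolomorphicDomain.domC p q, F x = (φ f).1 x)) := by
  have main : ∀ p q : ℕ, 1 < p → 1 < q → p ≠ q →
      HolomorphicDomain.IsUnboundedHomogeneousDomain (HolomorphicDomain.domD p q) ∧
      HolomorphicDomain.IsUnboundedHomogeneousDomain (HolomorphicDomain.domC p q) ∧
      ¬ HolomorphicDomain.Biholomorphic
          (HolomorphicDomain.domD p q) (HolomorphicDomain.domC p q) ∧
      ∃ φ : HolomorphicDomain.Aut (HolomorphicDomain.domD p q) ≃ₜ*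
          HolomorphicDomain.Aut (HolomorphicDomain.domC p q),
        ∀ f : HolomorphicDomain.Aut (HolomorphicDomain.domD p q),
          ∃ F : HolomorphicDomain.CSpace (p + q) ≃ HolomorphicDomain.CSpace (p + q),
            Differentiable ℂ F ∧ Differentiable ℂ F.symm ∧
            (∀ x : HolomorphicDomain.domD p q, F x = f.1 x) ∧
            (∀ x : HolomorphicDomain.domC p q, F x = (φ f).1 x) := by
    intro p q hp hq hpq
    have hD := HolomorphicDomain.hasEntireExtension_domD (q := q) hp
    have hC := HolomorphicDomain.hasEntireExtension_domC (p := p) hq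
    exact ⟨HolomorphicDomain.isUnboundedHomogeneousDomain_domD hp,
      HolomorphicDomain.isUnboundedHomogeneousDomain_domC hq,
      HolomorphicDomain.not_biholomorphic_domD_domC hp hq hpq,
      hD.transferEquiv hC (HolomorphicDomain.domC_eq_interior_compl hp)
        (HolomorphicDomain.domD_eq_interior_compl hq),
      fun f => ⟨hD.global f, hD.differentiable_global f, hD.differentiable_global_symm f,
        hD.global_apply f, fun _ => rfl⟩⟩
  refine ⟨fun n hn => ?_, main⟩
  -- Signature `(2, n - 2)`: `5 ≤ n` makes the second index at least `3`, hence different from `2`.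
  obtain ⟨q, rfl⟩ := Nat.exists_eq_add_of_le (show 2 ≤ n by omega)
  obtain ⟨h1, h2, h3, φ, -⟩ := main 2 q (by omega) (by omega) (by omega)
  exact ⟨_, _, h1, h2, h3, ⟨φ⟩⟩
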